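/- Let $G$ be a finite simple undirected connected graph on $n\ge 2$ vertices, and let $k\ge 3$ be an integer. Let $\mu_1\le\mu_2\le\cdots\le\mu_n$ be the eigenvalues, counted with multiplicity, of the Laplacian matrix $L=D-A$ of $G$, where $D$ is the diagonal matrix of vertex degrees and $A$ is the adjacency matrix. If $(k-1)\mu_2\ge\mu_n$, then $G$ has a spanning tree of maximum degree at most $k$. -/

import Mathlib

/-- The `i`-th smallest eigenvalue (`1 ≤ i ≤ n`, counted with multiplicity) of the Laplacian matrix
`L = D - A` of a graph on `n` vertices. Mathlib's `eigenvalues₀` lists the `n` eigenvalues in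
decreasing order with indices `0, …, n - 1`, so the `i`-th smallest one has index `n - i`. -/
noncomputable def SimpleGraph.lapEigenvalue {V : Type*} [Fintype V] [DecidableEq V]
    (G : SimpleGraph V) [DecidableRel G.Adj] (i : ℕ) (h1 : 1 ≤ i) (hn : i ≤ Fintype.card V) : ℝ :=
  (G.isHermitian_lapMatrix ℝ).eigenvalues₀ ⟨Fintype.card V - i, by omega⟩

/-!
Write `c(H)` for the number of components of a graph `H`. The proof combines a spectral bound on the
toughness of `G` with a toughness criterion for spanning trees of bounded degree.

*Spectral bound* (`SimpleGraph.Connected.card_component_isolate_le`). Let `S` be a set of `s`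
vertices, and let `C_1, …, C_c` be the components of `G - S`, of sizes `n_i` with sum `N = n - s`.
Evaluating the Laplacian form on centered indicator functions shows that a set of `a` vertices has
between `μ_2 a (n - a) / n` and `μ_n a (n - a) / n` leaving edges. All edges leaving some `C_i` end
in `S`, so `μ_2 ∑ n_i (n - n_i) ≤ μ_n s N ≤ (k - 1) μ_2 s N`. Since `n - n_i = s + (N - n_i)` and
`N - n_i ≥ c - 1`, dividing by `μ_2 N > 0` gives `c ≤ (k - 2) s + 1`.

*Toughness criterion* (`SimpleGraph.exists_isTree_of_card_component_isolate_le`), a slightly weaker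
form of a theorem of Win, by the argument of Ellingham and Zha. Let `F` be a spanning forest of `G`
of maximum degree at most `k` with as few components as possible. Call `H` an exchange away from `S`
if `H ≤ G` has maximum degree at most `k`, has the same edges at `S` as `F`, and `H - S` has the
same components as `F - S`. Build a set `S` greedily, adding a vertex as long as it has degree `k`
in all exchanges away from the vertices added before. Suppose that an edge `xy` of `G` joins two
components of `F - S` for the final `S`. There are exchanges away from `S` with degree less than `k`
at `x` and at `y`, respectively, and they can be combined into a single one
(`SimpleGraph.IsExchange.exists_combine`), to which `xy` can be added. If `x` and `y` were not joined
before, this contradicts the choice of `F`. If they were, some vertices of `S` lie on a path joining them; removing an edge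
of the path at the first of them to enter `S` is an exchange lowering the degree of that vertex,
which contradicts its choice. So `G - S` and `F - S` have the same components
(`SimpleGraph.exists_obstruction`). Counting edges of the forest `F`, whose degree is `k` at all
vertices of `S`, gives `c(G - S) ≥ c(F) + (k - 2)|S|`
(`SimpleGraph.IsAcyclic.card_component_isolate_ge`), so `c(F) ≤ 1` and `F` is a spanning tree.
-/

/-! ### Components and edges -/

namespace SimpleGraph

variable {V : Type*}

lemma reachable_le_of_forall_adj {H K : SimpleGraph V}
    (h : ∀ a b, H.Adj a b → K.Reachable a b) {a b : V} (hab : H.Reachable a b) :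
    K.Reachable a b := by
  obtain ⟨p⟩ := hab
  induction p with
  | nil => rfl
  | cons hadj _ ih => exact (h _ _ hadj).trans ih

lemma surjective_componentMap {H K : SimpleGraph V}
    (h : ∀ a b, H.Reachable a b → K.Reachable a b) :
    Function.Surjective (Quot.map id h : H.ConnectedComponent → K.ConnectedComponent) := by
  rintro ⟨v⟩
  exact ⟨H.connectedComponentMk v, rfl⟩

lemma card_component_lt_of_reachable [Finite V] {H K : SimpleGraph V}
    (h : ∀ a b, H.Reachable a b → K.Reachable a b) {u v : V} (hK : K.Reachable u v)
    (hH : ¬ H.Reachable u v) :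
    Nat.card K.ConnectedComponent < Nat.card H.ConnectedComponent := by
  have := Fintype.ofFinite H.ConnectedComponent
  have := Fintype.ofFinite K.ConnectedComponent
  rw [Nat.card_eq_fintype_card, Nat.card_eq_fintype_card]
  refine Fintype.card_lt_of_surjective_not_injective _ (surjective_componentMap h) fun hinj ↦ hH ?_
  exact ConnectedComponent.exact
    (hinj (a₁ := H.connectedComponentMk u) (a₂ := H.connectedComponentMk v)
      (ConnectedComponent.sound hK))

lemma card_component_congr {H K : SimpleGraph V} (h : H.Reachable = K.Reachable) :
    Nat.card H.ConnectedComponent = Nat.card K.ConnectedComponent := by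
  unfold ConnectedComponent
  rw [h]

/-- Deleting one edge splits off at most one new component. -/
lemma card_component_deleteEdges_le [Finite V] (H : SimpleGraph V) (u v : V) :
    Nat.card (H.deleteEdges {s(u, v)}).ConnectedComponent ≤
      Nat.card H.ConnectedComponent + 1 := by
  classical
  set K := H.deleteEdges {s(u, v)} with hK
  have key : ∀ a b, H.Reachable a b → K.Reachable a b ∨ (K.Reachable a u ∧ K.Reachable v b) ∨
      (K.Reachable a v ∧ K.Reachable u b) := by
    rintro a b ⟨p⟩
    induction p with
    | nil => exact Or.inl .rfl
    | @cons a c b hadj _ ih =>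
      by_cases hac : s(a, c) = s(u, v)
      · rcases Sym2.eq_iff.1 hac with ⟨rfl, rfl⟩ | ⟨rfl, rfl⟩
        · rcases ih with h | ⟨h, h'⟩ | ⟨h, h'⟩
          · exact Or.inr (Or.inl ⟨.rfl, h⟩)
          · exact Or.inr (Or.inl ⟨.rfl, h'⟩)
          · exact Or.inl h'
        · rcases ih with h | ⟨h, h'⟩ | ⟨h, h'⟩
          · exact Or.inr (Or.inr ⟨.rfl, h⟩)
          · exact Or.inl h'
          · exact Or.inr (Or.inr ⟨.rfl, h'⟩)
      · have hac' : K.Reachable a c := Adj.reachable (by simpa [hK, deleteEdges_adj, hadj] using hac)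
        rcases ih with h | ⟨h, h'⟩ | ⟨h, h'⟩
        · exact Or.inl (hac'.trans h)
        · exact Or.inr (Or.inl ⟨hac'.trans h, h'⟩)
        · exact Or.inr (Or.inr ⟨hac'.trans h, h'⟩)
  -- Away from the component of `v`, the map onto the components of `H` is injective.
  let f : K.ConnectedComponent → Option H.ConnectedComponent := fun C ↦
    if C = K.connectedComponentMk v then none
    else some (Quot.map id (fun _ _ h ↦ h.mono (deleteEdges_le _)) C)
  have hf : Function.Injective f := by
    rintro ⟨a⟩ ⟨b⟩ hab
    change f (K.connectedComponentMk a) = f (K.connectedComponentMk b) at hab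
    change K.connectedComponentMk a = K.connectedComponentMk b
    by_cases ha : K.connectedComponentMk a = K.connectedComponentMk v <;>
      by_cases hb : K.connectedComponentMk b = K.connectedComponentMk v
    · rw [ha, hb]
    · simp [f, ha, hb] at hab
    · simp [f, ha, hb] at hab
    · simp only [f, ha, hb, if_false] at hab
      have hr : H.Reachable a b := ConnectedComponent.exact (Option.some.inj hab)
      rcases key a b hr with h | ⟨_, h⟩ | ⟨h, _⟩
      · exact ConnectedComponent.sound h
      · exact absurd (ConnectedComponent.sound h.symm) hb
      · exact absurd (ConnectedComponent.sound h) ha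
  have := Nat.card_le_card_of_injective f hf
  rwa [Finite.card_option] at this

lemma card_edgeSet_deleteEdges_singleton [Finite V] {H : SimpleGraph V} {e : Sym2 V}
    (he : e ∈ H.edgeSet) : Nat.card (H.deleteEdges {e}).edgeSet + 1 = Nat.card H.edgeSet := by
  rw [edgeSet_deleteEdges, Nat.card_coe_set_eq, Nat.card_coe_set_eq,
    Set.ncard_sdiff_singleton_add_one he]

lemma card_le_card_component_add_card_edgeSet [Finite V] (H : SimpleGraph V) :
    Nat.card V ≤ Nat.card H.ConnectedComponent + Nat.card H.edgeSet := by
  induction hm : Nat.card H.edgeSet generalizing H with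
  | zero =>
    refine Nat.card_le_card_of_injective H.connectedComponentMk fun a b hab ↦ ?_
    obtain rfl : H = ⊥ := by
      rw [← edgeSet_eq_empty, ← Set.ncard_eq_zero, ← Nat.card_coe_set_eq, hm]
    simpa using ConnectedComponent.exact hab
  | succ m ih =>
    obtain ⟨e, he⟩ : H.edgeSet.Nonempty := by
      rw [← Set.ncard_pos, ← Nat.card_coe_set_eq]; omega
    have h1 := card_edgeSet_deleteEdges_singleton he
    have h2 := ih (H.deleteEdges {e}) (by omega)
    cases e with | h u v =>
    have h3 := H.card_component_deleteEdges_le u v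
    omega

lemma IsAcyclic.card_component_add_card_edgeSet_le [Finite V] {H : SimpleGraph V}
    (hH : H.IsAcyclic) : Nat.card H.ConnectedComponent + Nat.card H.edgeSet ≤ Nat.card V := by
  induction hm : Nat.card H.edgeSet generalizing H with
  | zero => exact Nat.card_le_card_of_surjective H.connectedComponentMk Quot.mk_surjective
  | succ m ih =>
    obtain ⟨e, he⟩ : H.edgeSet.Nonempty := by
      rw [← Set.ncard_pos, ← Nat.card_coe_set_eq]; omega
    have h1 := card_edgeSet_deleteEdges_singleton he
    have h2 := ih (hH.anti (deleteEdges_le {e})) (by omega)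
    cases e with | h u v =>
    have h3 := card_component_lt_of_reachable (fun _ _ h ↦ h.mono (deleteEdges_le {s(u, v)}))
      (Adj.reachable he) (isAcyclic_iff_forall_isBridge.1 hH he)
    omega

/-! ### Deleting a set of vertices -/

/-- The graph `H - S`, kept on the whole vertex type: all edges meeting `S` are deleted, so that
the vertices of `S` become isolated. It has `|S|` more components than the induced graph on the
complement of `S`. -/
def isolate (H : SimpleGraph V) (S : Set V) : SimpleGraph V where
  Adj a b := H.Adj a b ∧ a ∉ S ∧ b ∉ S
  symm := ⟨fun _ _ h ↦ ⟨h.1.symm, h.2.2, h.2.1⟩⟩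
  loopless := ⟨fun _ h ↦ h.1.ne rfl⟩

lemma isolate_adj {H : SimpleGraph V} {S : Set V} {a b : V} :
    (H.isolate S).Adj a b ↔ H.Adj a b ∧ a ∉ S ∧ b ∉ S := Iff.rfl

lemma isolate_le (H : SimpleGraph V) (S : Set V) : H.isolate S ≤ H := fun _ _ h ↦ h.1

lemma isolate_anti (H : SimpleGraph V) {S S' : Set V} (h : S' ⊆ S) :
    H.isolate S ≤ H.isolate S' :=
  fun _ _ hab ↦ ⟨hab.1, fun ha ↦ hab.2.1 (h ha), fun hb ↦ hab.2.2 (h hb)⟩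

lemma isolate_mono {H K : SimpleGraph V} (h : H ≤ K) (S : Set V) : H.isolate S ≤ K.isolate S :=
  fun _ _ hab ↦ ⟨h hab.1, hab.2⟩

lemma eq_of_reachable_isolate {H : SimpleGraph V} {S : Set V} {a b : V}
    (h : (H.isolate S).Reachable a b) (ha : a ∈ S) : a = b := by
  obtain ⟨p⟩ := h
  cases p with
  | nil => rfl
  | cons hadj _ => exact absurd ha hadj.2.1

open Classical in
lemma two_mul_card_edgeSet [Fintype V] (H : SimpleGraph V) :
    2 * (Nat.card H.edgeSet : ℤ) = ∑ a, ∑ b, if H.Adj a b then 1 else 0 := by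
  rw [Nat.card_eq_fintype_card, ← edgeFinset_card]
  have h := H.sum_degrees_eq_twice_card_edges
  have : ∀ a, (H.degree a : ℤ) = ∑ b, if H.Adj a b then 1 else 0 :=
    fun a ↦ H.degree_eq_sum_if_adj a
  simp_rw [← this]
  exact_mod_cast h.symm

open Classical in
lemma ncard_neighborSet_eq_sum [Fintype V] (H : SimpleGraph V) (v : V) :
    ((H.neighborSet v).ncard : ℤ) = ∑ b, if H.Adj v b then 1 else 0 := by
  rw [← H.degree_eq_sum_if_adj v, ← card_neighborSet_eq_degree, ← Nat.card_eq_fintype_card,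
    Nat.card_coe_set_eq]

/-- The edges of `F` split into those of `F - S`, and those counted by the degrees in `S`, where
the edges inside `S` are counted twice. -/
lemma card_edgeSet_add_card_edgeSet_isolate [Finite V] (F : SimpleGraph V) (S : Finset V) :
    Nat.card (F.isolate S).edgeSet + ∑ s ∈ S, (F.neighborSet s).ncard =
      Nat.card F.edgeSet + Nat.card (F.isolate (S : Set V)ᶜ).edgeSet := by
  classical
  have := Fintype.ofFinite V
  have hS (g : V → ℤ) : ∑ s ∈ S, g s = ∑ s, if s ∈ S then g s else 0 := by simp
  have h4 : ∑ s ∈ S, ((F.neighborSet s).ncard : ℤ) =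
      ∑ a, ∑ b, if a ∈ S ∧ F.Adj a b then 1 else 0 := by
    simp_rw [ncard_neighborSet_eq_sum, hS]
    refine Finset.sum_congr rfl fun a _ ↦ ?_
    by_cases ha : a ∈ S <;> simp [ha]
  have h5 : ∑ s ∈ S, ((F.neighborSet s).ncard : ℤ) =
      ∑ a, ∑ b, if b ∈ S ∧ F.Adj a b then 1 else 0 := by
    rw [h4, Finset.sum_comm]
    simp_rw [F.adj_comm]
  zify
  have h1 := two_mul_card_edgeSet F
  have h2 := two_mul_card_edgeSet (F.isolate S)
  have h3 := two_mul_card_edgeSet (F.isolate (S : Set V)ᶜ)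
  have key : ∑ a, ∑ b, ((if (F.isolate S).Adj a b then 1 else 0 : ℤ) +
      (if a ∈ S ∧ F.Adj a b then 1 else 0) + (if b ∈ S ∧ F.Adj a b then 1 else 0)) =
      ∑ a, ∑ b, ((if F.Adj a b then 1 else 0 : ℤ) +
        (if (F.isolate (S : Set V)ᶜ).Adj a b then 1 else 0)) := by
    refine Finset.sum_congr rfl fun a _ ↦ Finset.sum_congr rfl fun b _ ↦ ?_
    by_cases h : F.Adj a b <;> by_cases ha : a ∈ S <;> by_cases hb : b ∈ S <;>
      simp [isolate_adj, h, ha, hb]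
  simp_rw [Finset.sum_add_distrib] at key
  linarith

/-- Deleting from a forest `F` a set `S` of vertices of degree `k` leaves many components; with the
vertices of `S` counted as components of `F.isolate S`, there are at least
`c(F) + k|S| - |S|` of them. -/
lemma IsAcyclic.card_component_isolate_ge [Finite V] {F : SimpleGraph V} (hF : F.IsAcyclic)
    {k : ℕ} {S : Finset V} (hS : ∀ s ∈ S, (F.neighborSet s).ncard = k) :
    Nat.card F.ConnectedComponent + k * S.card ≤
      Nat.card (F.isolate S).ConnectedComponent + S.card := by
  have := Fintype.ofFinite V
  have h1 := card_le_card_component_add_card_edgeSet (F.isolate S)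
  have h2 := hF.card_component_add_card_edgeSet_le
  have h3 := F.card_edgeSet_add_card_edgeSet_isolate S
  have h4 := (hF.anti (F.isolate_le (S : Set V)ᶜ)).card_component_add_card_edgeSet_le
  -- The vertices outside `S` are isolated in the forest `F[S]`, which thus has at most `|S|` edges.
  have h5 : Nat.card ((S : Set V)ᶜ : Set V) ≤
      Nat.card (F.isolate (S : Set V)ᶜ).ConnectedComponent := by
    refine Nat.card_le_card_of_injective
      (fun v ↦ (F.isolate (S : Set V)ᶜ).connectedComponentMk v) fun a b hab ↦ ?_
    exact Subtype.ext (eq_of_reachable_isolate (ConnectedComponent.exact hab) a.2)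
  rw [Nat.card_coe_set_eq] at h5
  have h6 := Set.ncard_add_ncard_compl (S : Set V)
  rw [Set.ncard_coe_finset] at h6
  rw [Finset.sum_congr rfl hS, Finset.sum_const, smul_eq_mul, mul_comm] at h3
  omega

end SimpleGraph

/-! ### Exchanges and spanning trees of bounded degree -/

namespace SimpleGraph

variable {V : Type*}

/-- `H` is obtained from `F` by an exchange away from `S`: a subgraph of `G` of maximum degree at
most `k` which has the same edges at `S` as `F`, and for which `H - S` has the same components
(as vertex sets) as `F - S`. -/
structure IsExchange (G F : SimpleGraph V) (k : ℕ) (S : Set V) (H : SimpleGraph V) : Prop where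
  le : H ≤ G
  ncard_le : ∀ v, (H.neighborSet v).ncard ≤ k
  adj_iff : ∀ s ∈ S, ∀ v, H.Adj s v ↔ F.Adj s v
  reachable_eq : (H.isolate S).Reachable = (F.isolate S).Reachable

lemma isolate_reachable_of_agree {H F : SimpleGraph V} {S S' : Set V} (hS : S' ⊆ S)
    (hadj : ∀ s ∈ S, ∀ v, H.Adj s v ↔ F.Adj s v)
    (hr : (H.isolate S).Reachable = (F.isolate S).Reachable) {a b : V}
    (hab : (H.isolate S').Reachable a b) : (F.isolate S').Reachable a b := by
  refine reachable_le_of_forall_adj (fun a b h ↦ ?_) hab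
  by_cases ha : a ∈ S
  · exact Adj.reachable ⟨(hadj a ha b).1 h.1, h.2⟩
  by_cases hb : b ∈ S
  · exact Adj.reachable ⟨((hadj b hb a).1 h.1.symm).symm, h.2⟩
  have : (F.isolate S).Reachable a b := hr ▸ Adj.reachable ⟨h.1, ha, hb⟩
  exact this.mono (F.isolate_anti hS)

namespace IsExchange

variable {G F H : SimpleGraph V} {k : ℕ} {S S' : Set V}

lemma refl (hle : F ≤ G) (hdeg : ∀ v, (F.neighborSet v).ncard ≤ k) : IsExchange G F k S F :=
  ⟨hle, hdeg, fun _ _ _ ↦ Iff.rfl, rfl⟩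

lemma anti (h : IsExchange G F k S H) (hS : S' ⊆ S) : IsExchange G F k S' H where
  le := h.le
  ncard_le := h.ncard_le
  adj_iff s hs := h.adj_iff s (hS hs)
  reachable_eq := by
    ext a b
    exact ⟨isolate_reachable_of_agree hS h.adj_iff h.reachable_eq,
      isolate_reachable_of_agree hS (fun s hs v ↦ (h.adj_iff s hs v).symm) h.reachable_eq.symm⟩

lemma reachable_iff (h : IsExchange G F k S H) {a b : V} :
    H.Reachable a b ↔ F.Reachable a b := by
  have h0 : ∀ K : SimpleGraph V, K.isolate ∅ = K := fun K ↦ by ext; simp [isolate_adj]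
  have := (h.anti (Set.empty_subset S)).reachable_eq
  rw [h0, h0] at this
  rw [this]

/-- Exchanges in different components of `F - S` can be carried out simultaneously: use `H₁` on the
component of `x` and `H₂` elsewhere. -/
lemma exists_combine [Finite V] {H₁ H₂ : SimpleGraph V} (h₁ : IsExchange G F k S H₁)
    (h₂ : IsExchange G F k S H₂) {x y : V} (hx : x ∉ S) (hy : y ∉ S)
    (hxy : ¬ (F.isolate S).Reachable x y) :
    ∃ H, IsExchange G F k S H ∧ H.neighborSet x = H₁.neighborSet x ∧
      H.neighborSet y = H₂.neighborSet y := by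
  classical
  set C : Set V := {v | (F.isolate S).Reachable x v} with hC
  have hxC : x ∈ C := Reachable.refl x
  have hCS : ∀ v ∈ C, v ∉ S := fun v hv hvS ↦
    hx (eq_of_reachable_isolate (Reachable.symm hv) hvS ▸ hvS)
  -- Edges of `H₁` and `H₂` with both ends outside `S` do not leave `C`.
  have closed : ∀ K, IsExchange G F k S K → ∀ a b, K.Adj a b → a ∈ C → b ∉ S → b ∈ C := by
    intro K hK a b hab ha hb
    have : (F.isolate S).Reachable a b := hK.reachable_eq ▸ Adj.reachable ⟨hab, hCS a ha, hb⟩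
    exact Reachable.trans ha this
  let H : SimpleGraph V :=
    { Adj := fun a b ↦ if a ∈ C ∨ b ∈ C then H₁.Adj a b else H₂.Adj a b
      symm := ⟨fun a b h ↦ by
        by_cases hab : a ∈ C ∨ b ∈ C
        · rw [if_pos hab] at h; rw [if_pos hab.symm]; exact h.symm
        · rw [if_neg hab] at h; rw [if_neg (fun h' ↦ hab h'.symm)]; exact h.symm⟩
      loopless := ⟨fun a h ↦ by split_ifs at h <;> exact h.ne rfl⟩ }
  have hH : ∀ a b, H.Adj a b ↔ if a ∈ C ∨ b ∈ C then H₁.Adj a b else H₂.Adj a b :=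
    fun _ _ ↦ Iff.rfl
  have hS : ∀ s ∈ S, ∀ v, H.Adj s v ↔ F.Adj s v := by
    intro s hs v
    rw [hH, h₁.adj_iff s hs, h₂.adj_iff s hs, ite_self]
  have hin : ∀ v ∈ C, H.neighborSet v = H₁.neighborSet v := by
    intro v hv
    ext w
    simp [hH, hv]
  have hout : ∀ v, v ∉ C → v ∉ S → H.neighborSet v = H₂.neighborSet v := by
    intro v hv hvS
    ext w
    rw [mem_neighborSet, mem_neighborSet, hH]
    by_cases hw : w ∈ C
    · rw [if_pos (Or.inr hw)]
      exact ⟨fun h ↦ absurd (closed _ h₁ _ _ h.symm hw hvS) hv,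
        fun h ↦ absurd (closed _ h₂ _ _ h.symm hw hvS) hv⟩
    · rw [if_neg (by tauto)]
  refine ⟨H, ⟨?_, ?_, hS, ?_⟩, hin x hxC, hout y hxy hy⟩
  · intro a b hab
    rw [hH] at hab
    split_ifs at hab
    · exact h₁.le hab
    · exact h₂.le hab
  · intro v
    by_cases hv : v ∈ C
    · rw [hin v hv]; exact h₁.ncard_le v
    by_cases hvS : v ∈ S
    · have : H.neighborSet v = H₁.neighborSet v := by
        ext w
        rw [mem_neighborSet, mem_neighborSet, hS v hvS, h₁.adj_iff v hvS]
      rw [this]; exact h₁.ncard_le v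
    · rw [hout v hv hvS]; exact h₂.ncard_le v
  · ext a b
    constructor
    · refine reachable_le_of_forall_adj fun a b hab ↦ ?_
      have h := hab.1
      rw [hH] at h
      split_ifs at h
      · exact h₁.reachable_eq ▸ Adj.reachable ⟨h, hab.2⟩
      · exact h₂.reachable_eq ▸ Adj.reachable ⟨h, hab.2⟩
    · intro hab
      by_cases ha : a ∈ C
      · rw [← h₁.reachable_eq] at hab
        obtain ⟨p⟩ := hab
        induction p with
        | nil => rfl
        | @cons a c b h _ ih =>
          have hac : (H.isolate S).Adj a c :=
            ⟨(hH _ _).2 (by rw [if_pos (Or.inl ha)]; exact h.1), h.2⟩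
          exact hac.reachable.trans (ih (closed _ h₁ _ _ h.1 ha h.2.2))
      · rw [← h₂.reachable_eq] at hab
        obtain ⟨p⟩ := hab
        induction p with
        | nil => rfl
        | @cons a c b h _ ih =>
          have hc : c ∉ C := fun hc ↦ ha (closed _ h₂ _ _ h.1.symm hc h.2.1)
          have hac : (H.isolate S).Adj a c :=
            ⟨(hH _ _).2 (by rw [if_neg (by tauto)]; exact h.1), h.2⟩
          exact hac.reachable.trans (ih hc)

end IsExchange

section Swap

variable [Finite V] {H : SimpleGraph V} {k : ℕ} {x y : V}

lemma ncard_neighborSet_sup_edge_le (hdeg : ∀ v, (H.neighborSet v).ncard ≤ k)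
    (hx : (H.neighborSet x).ncard < k) (hy : (H.neighborSet y).ncard < k) (v : V) :
    ((H ⊔ edge x y).neighborSet v).ncard ≤ k := by
  by_cases hvx : v = x
  · subst hvx
    have : (H ⊔ edge v y).neighborSet v ⊆ insert y (H.neighborSet v) := by
      intro w hw
      simp only [mem_neighborSet, sup_adj, edge_adj, Set.mem_insert_iff] at hw ⊢
      grind
    exact (Set.ncard_le_ncard this).trans ((Set.ncard_insert_le _ _).trans hx)
  by_cases hvy : v = y
  · subst hvy
    have : (H ⊔ edge x v).neighborSet v ⊆ insert x (H.neighborSet v) := by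
      intro w hw
      simp only [mem_neighborSet, sup_adj, edge_adj, Set.mem_insert_iff] at hw ⊢
      grind
    exact (Set.ncard_le_ncard this).trans ((Set.ncard_insert_le _ _).trans hy)
  · refine (Set.ncard_le_ncard fun w hw ↦ ?_).trans (hdeg v)
    simp only [mem_neighborSet, sup_adj, edge_adj] at hw ⊢
    grind

/-- If `x` and `y` are joined in `H` but not in `H - S`, then adding the edge `xy` to `H` and
removing an edge `st` with `s ∈ S` from the resulting cycle gives an exchange away from `S \ Z`,
where `Z` consists of the vertices of `S` on the cycle. -/
lemma IsExchange.exists_swap {G F : SimpleGraph V} {S : Set V} (h : IsExchange G F k S H)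
    (hx : x ∉ S) (hy : y ∉ S) (hxy : G.Adj x y) (hr : H.Reachable x y)
    (hnr : ¬ (F.isolate S).Reachable x y) (hdx : (H.neighborSet x).ncard < k)
    (hdy : (H.neighborSet y).ncard < k) :
    ∃ Z ⊆ S, Z.Nonempty ∧ ∀ s ∈ Z, ∃ H', IsExchange G F k (S \ Z) H' ∧
      (H'.neighborSet s).ncard < k := by
  classical
  rw [← h.reachable_eq] at hnr
  obtain ⟨p, hp⟩ := hr.exists_isPath
  have hnadj : ¬ H.Adj x y := fun hadj ↦ hnr (Adj.reachable ⟨hadj, hx, hy⟩)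
  have hsupp : ∀ e ∈ p.edges, ∀ v ∈ e, v ∈ p.support := fun e he v hv ↦
    p.mem_support_iff_exists_mem_edges.2 (Or.inr ⟨e, he, hv⟩)
  -- `p` lives in `H - S'` as soon as `S'` avoids its vertices.
  have htrans : ∀ S' : Set V, (∀ v ∈ p.support, v ∉ S') →
      ∀ e ∈ p.edges, e ∈ (H.isolate S').edgeSet := by
    intro S' hS' e he
    have h1 := p.edges_subset_edgeSet he
    have h2 := hsupp e he
    cases e with | h a b =>
    exact ⟨h1, hS' a (h2 a (by simp)), hS' b (h2 b (by simp))⟩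
  set Z : Set V := {v ∈ S | v ∈ p.support} with hZ
  have hZS : ∀ v ∈ p.support, v ∉ S \ Z := fun v hv hvS ↦ hvS.2 ⟨hvS.1, hv⟩
  refine ⟨Z, fun v hv ↦ hv.1, ?_, ?_⟩
  · by_contra hne
    refine hnr ⟨p.transfer _ (htrans S fun v hv hvS ↦ hne ⟨v, hvS, hv⟩)⟩
  rintro s ⟨hsS, hsp⟩
  have hsx : s ≠ x := fun e ↦ hx (e ▸ hsS)
  have hsy : s ≠ y := fun e ↦ hy (e ▸ hsS)
  obtain ⟨t, hst⟩ : ∃ t, s(s, t) ∈ p.edges := by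
    rcases p.mem_support_iff_exists_mem_edges.1 hsp with rfl | ⟨e, he, hse⟩
    · exact absurd rfl hsy
    · obtain ⟨t, rfl⟩ := Sym2.mem_iff_exists.1 hse
      exact ⟨t, he⟩
  have hHst : H.Adj s t := p.edges_subset_edgeSet hst
  have hexch := h.anti (Set.sdiff_subset : S \ Z ⊆ S)
  set H' := H.deleteEdges {s(s, t)} ⊔ edge x y with hH'
  have hH'le : H' ≤ H ⊔ edge x y := sup_le_sup_right (deleteEdges_le _) _
  have hsZ : s ∉ S \ Z := hZS s hsp
  have htZ : t ∉ S \ Z := hZS t (hsupp _ hst t (by simp))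
  have hadj : ∀ a b, H'.Adj a b ↔ (H.Adj a b ∧ s(a, b) ≠ s(s, t)) ∨ (edge x y).Adj a b := by
    intro a b
    simp [hH', deleteEdges_adj]
  -- the cycle formed by `p` and `xy` shows that `s` and `t` remain joined
  have hcyc : (H'.isolate (S \ Z)).Reachable s t := by
    set K := H.isolate (S \ Z) ⊔ edge x y with hK
    have hpK : ∀ e ∈ p.edges, e ∈ K.edgeSet := fun e he ↦
      edgeSet_mono le_sup_left (htrans _ hZS e he)
    have hyx : K.Adj y x := Or.inr ((edge_adj ..).2 ⟨Or.inr ⟨rfl, rfl⟩, hxy.ne'⟩)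
    have hc : (Walk.cons hyx (p.transfer K hpK)).IsCycle := by
      rw [Walk.cons_isCycle_iff]
      refine ⟨hp.transfer hpK, fun hmem ↦ hnadj ?_⟩
      rw [Walk.edges_transfer] at hmem
      exact (p.edges_subset_edgeSet hmem : H.Adj y x).symm
    have hreach := (adj_and_reachable_delete_edges_iff_exists_cycle.2
      ⟨_, _, hc, by rw [Walk.edges_cons, Walk.edges_transfer]; exact List.mem_cons_of_mem _ hst⟩ :
        K.Adj s t ∧ (K.deleteEdges {s(s, t)}).Reachable s t).2
    refine hreach.mono fun a b hab ↦ ?_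
    rw [deleteEdges_adj] at hab
    rcases hab.1 with h1 | h1
    · exact ⟨(hadj a b).2 (Or.inl ⟨h1.1, hab.2⟩), h1.2⟩
    · refine ⟨(hadj a b).2 (Or.inr h1), ?_⟩
      rw [edge_adj] at h1
      rcases h1.1 with ⟨rfl, rfl⟩ | ⟨rfl, rfl⟩
      · exact ⟨fun h ↦ hx h.1, fun h ↦ hy h.1⟩
      · exact ⟨fun h ↦ hy h.1, fun h ↦ hx h.1⟩
  have hpr : (H.isolate (S \ Z)).Reachable x y := ⟨p.transfer _ (htrans _ hZS)⟩
  refine ⟨H', ⟨?_, ?_, ?_, ?_⟩, ?_⟩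
  · exact hH'le.trans (sup_le h.le ((edge_le_iff _).2 (Or.inr hxy)))
  · exact fun v ↦ (Set.ncard_le_ncard fun w hw ↦ hH'le hw).trans
      (ncard_neighborSet_sup_edge_le h.ncard_le hdx hdy v)
  · intro u hu v
    rw [hadj, ← hexch.adj_iff u hu]
    have h1 : u ≠ s := fun e ↦ hsZ (e ▸ hu)
    have h2 : u ≠ t := fun e ↦ htZ (e ▸ hu)
    have h3 : u ≠ x := fun e ↦ hx (e ▸ hu.1)
    have h4 : u ≠ y := fun e ↦ hy (e ▸ hu.1)
    simp [edge_adj, h1, h2, h3, h4]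
  · rw [← hexch.reachable_eq]
    ext a b
    constructor
    · refine reachable_le_of_forall_adj fun a b hab ↦ ?_
      rcases (hadj a b).1 hab.1 with h1 | h1
      · exact Adj.reachable ⟨h1.1, hab.2⟩
      · rw [edge_adj] at h1
        rcases h1.1 with ⟨rfl, rfl⟩ | ⟨rfl, rfl⟩
        · exact hpr
        · exact hpr.symm
    · refine reachable_le_of_forall_adj fun a b hab ↦ ?_
      by_cases he : s(a, b) = s(s, t)
      · rcases Sym2.eq_iff.1 he with ⟨rfl, rfl⟩ | ⟨rfl, rfl⟩
        · exact hcyc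
        · exact hcyc.symm
      · exact Adj.reachable ⟨(hadj a b).2 (Or.inl ⟨hab.1, he⟩), hab.2⟩
  · refine lt_of_lt_of_le (Set.ncard_lt_ncard ?_) (h.ncard_le s)
    refine ⟨fun w hw ↦ ?_, fun hsub ↦ ?_⟩
    · rcases (hadj s w).1 hw with h1 | h1
      · exact h1.1
      · simp [edge_adj, hsx, hsy] at h1
    · have h1 : H'.Adj s t := hsub hHst
      simp [hadj, edge_adj, hsx, hsy] at h1

end Swap

/-- The set which obstructs adding an edge to `F`: if no subgraph of `G` of maximum degree at most
`k` has fewer components than `F`, there is a set `S` of vertices, all of degree `k` in `F`, such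
that no edge of `G` joins two components of `F - S`. -/
lemma exists_obstruction [Finite V] {G F : SimpleGraph V} {k : ℕ} (hle : F ≤ G)
    (hdeg : ∀ v, (F.neighborSet v).ncard ≤ k)
    (hmin : ∀ H ≤ G, (∀ v, (H.neighborSet v).ncard ≤ k) →
      Nat.card F.ConnectedComponent ≤ Nat.card H.ConnectedComponent) :
    ∃ S : Set V, (∀ s ∈ S, (F.neighborSet s).ncard = k) ∧
      (G.isolate S).Reachable = (F.isolate S).Reachable := by
  -- `S` is a maximal set that can be built up by successively adding vertices that keep degree `k`
  -- under all exchanges away from the earlier ones.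
  let P : Set V → Prop := fun S ↦ ∀ Z ⊆ S, Z.Nonempty →
    ∃ s ∈ Z, ∀ H, IsExchange G F k (S \ Z) H → (H.neighborSet s).ncard = k
  have hP0 : P ∅ := fun Z hZ hne ↦ absurd (Set.subset_empty_iff.1 hZ) hne.ne_empty
  obtain ⟨S, -, hS⟩ := Finite.exists_le_maximal (p := P) hP0
  have hfree : ∀ v ∉ S, ∃ H, IsExchange G F k S H ∧ (H.neighborSet v).ncard < k := by
    intro v hv
    by_contra! hcon
    have hfix : ∀ H, IsExchange G F k S H → (H.neighborSet v).ncard = k :=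
      fun H hH ↦ le_antisymm (hH.ncard_le v) (hcon H hH)
    have hPv : P (insert v S) := by
      intro Z hZ hne
      by_cases hZv : (Z \ {v}).Nonempty
      · obtain ⟨s, hs, hsk⟩ := hS.1 (Z \ {v})
          (fun w hw ↦ (hZ hw.1).resolve_left hw.2) hZv
        refine ⟨s, hs.1, fun H hH ↦ hsk H (hH.anti fun w hw ↦ ⟨Or.inr hw.1, fun hwZ ↦ ?_⟩)⟩
        exact hw.2 ⟨hwZ, fun e ↦ hv (e ▸ hw.1)⟩
      · have hZ' : Z ⊆ {v} := Set.sdiff_eq_empty.1 (Set.not_nonempty_iff_eq_empty.1 hZv)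
        obtain ⟨w, hw⟩ := hne
        obtain rfl : w = v := hZ' hw
        exact ⟨w, hw, fun H hH ↦ hfix H (hH.anti fun u hu ↦
          ⟨Or.inr hu, fun huZ ↦ hv (hZ' huZ ▸ hu)⟩)⟩
    exact hv (hS.2 hPv (Set.subset_insert v S) (Set.mem_insert v S))
  refine ⟨S, fun s hs ↦ ?_, ?_⟩
  · obtain ⟨t, ht, h⟩ := hS.1 {s} (by simpa using hs) (Set.singleton_nonempty s)
    obtain rfl : t = s := ht
    exact h F (.refl hle hdeg)
  · ext a b
    refine ⟨reachable_le_of_forall_adj fun x y hxy ↦ ?_,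
      Reachable.mono (isolate_mono hle S)⟩
    by_contra hnr
    obtain ⟨H₁, h₁, hd₁⟩ := hfree x hxy.2.1
    obtain ⟨H₂, h₂, hd₂⟩ := hfree y hxy.2.2
    obtain ⟨H, h, hHx, hHy⟩ := h₁.exists_combine h₂ hxy.2.1 hxy.2.2 hnr
    rw [← hHx] at hd₁
    rw [← hHy] at hd₂
    by_cases hr : H.Reachable x y
    · obtain ⟨Z, hZS, hZ, hswap⟩ := h.exists_swap hxy.2.1 hxy.2.2 hxy.1 hr hnr hd₁ hd₂
      obtain ⟨s, hs, hsk⟩ := hS.1 Z hZS hZ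
      obtain ⟨H', hH', hlt⟩ := hswap s hs
      exact hlt.ne (hsk H' hH')
    · have h3 : Nat.card (H ⊔ edge x y).ConnectedComponent < Nat.card H.ConnectedComponent :=
        card_component_lt_of_reachable (fun _ _ h ↦ h.mono le_sup_left)
          ((edge_le_iff _).1 le_sup_right |>.resolve_left hxy.1.ne).reachable hr
      have h4 : Nat.card H.ConnectedComponent = Nat.card F.ConnectedComponent :=
        card_component_congr (by ext; exact h.reachable_iff)
      have h5 := hmin (H ⊔ edge x y) (sup_le h.le ((edge_le_iff _).2 (Or.inr hxy.1)))
        (ncard_neighborSet_sup_edge_le h.ncard_le hd₁ hd₂)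
      omega

/-- A toughness criterion for the existence of a spanning tree of maximum degree at most `k`.
Since the vertices of `S` count as components of `G.isolate S`, the hypothesis says that `G - S` has
at most `(k - 2)|S| + 1` components. -/
theorem exists_isTree_of_card_component_isolate_le [Finite V] [Nonempty V] {G : SimpleGraph V}
    {k : ℕ} (hG : ∀ S : Finset V,
      Nat.card (G.isolate S).ConnectedComponent + S.card ≤ k * S.card + 1) :
    ∃ T ≤ G, T.IsTree ∧ ∀ v, (T.neighborSet v).ncard ≤ k := by
  classical
  have := Fintype.ofFinite V
  obtain ⟨F₀, ⟨hle₀, hdeg₀⟩, hmin⟩ := exists_minimalFor_of_wellFoundedLT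
    (fun H : SimpleGraph V ↦ H ≤ G ∧ ∀ v, (H.neighborSet v).ncard ≤ k)
    (fun H ↦ Nat.card H.ConnectedComponent)
    ⟨⊥, bot_le, fun v ↦ by simp⟩
  obtain ⟨F, hFle, hF, hFr⟩ := F₀.exists_isAcyclic_reachable_eq_le
  have hdeg : ∀ v, (F.neighborSet v).ncard ≤ k := fun v ↦
    (Set.ncard_le_ncard fun w hw ↦ hFle hw).trans (hdeg₀ v)
  obtain ⟨S, hSk, hSr⟩ := exists_obstruction (hFle.trans hle₀) hdeg fun H hH hHk ↦ by
    rw [card_component_congr hFr]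
    exact (le_total _ _).elim id fun h ↦ hmin ⟨hH, hHk⟩ h
  have h1 := hF.card_component_isolate_ge (k := k) (S := S.toFinset) (by simpa using hSk)
  have h2 := hG S.toFinset
  rw [Set.coe_toFinset] at h1 h2
  rw [card_component_congr hSr] at h2
  have h3 : Nat.card F.ConnectedComponent ≤ 1 := by omega
  refine ⟨F, hFle.trans hle₀, ⟨⟨fun a b ↦ ?_⟩, hF⟩, hdeg⟩
  have : Subsingleton F.ConnectedComponent := Finite.card_le_one_iff_subsingleton.1 h3
  exact ConnectedComponent.exact (Subsingleton.elim _ _)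

end SimpleGraph

/-! ### Eigenvalues and quadratic forms -/

namespace Matrix.IsHermitian

variable {n : Type*} [Fintype n] [DecidableEq n] {A : Matrix n n ℝ}

/-- Parseval's identity for the eigenbasis. -/
lemma sum_eigenvectorBasis_dotProduct_mul (hA : A.IsHermitian) (x y : n → ℝ) :
    ∑ i, (⇑(hA.eigenvectorBasis i) ⬝ᵥ x) * (⇑(hA.eigenvectorBasis i) ⬝ᵥ y) = x ⬝ᵥ y := by
  have h := hA.eigenvectorBasis.sum_inner_mul_inner (WithLp.toLp 2 x) (WithLp.toLp 2 y)
  simp only [EuclideanSpace.inner_eq_star_dotProduct, star_trivial] at h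
  rw [dotProduct_comm y x] at h
  rw [← h]
  exact Finset.sum_congr rfl fun i _ ↦ by rw [dotProduct_comm y]

lemma eigenvectorBasis_dotProduct_mulVec (hA : A.IsHermitian) (i : n) (x : n → ℝ) :
    ⇑(hA.eigenvectorBasis i) ⬝ᵥ (A *ᵥ x) =
      hA.eigenvalues i * (⇑(hA.eigenvectorBasis i) ⬝ᵥ x) := by
  have hT : Aᵀ = A := by simpa [Matrix.IsHermitian, conjTranspose_eq_transpose_of_trivial] using hA
  rw [dotProduct_mulVec, ← mulVec_transpose, hT, hA.mulVec_eigenvectorBasis, smul_dotProduct,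
    smul_eq_mul]

lemma dotProduct_mulVec_eq_sum (hA : A.IsHermitian) (x : n → ℝ) :
    x ⬝ᵥ (A *ᵥ x) = ∑ i, hA.eigenvalues i * (⇑(hA.eigenvectorBasis i) ⬝ᵥ x) ^ 2 := by
  rw [← hA.sum_eigenvectorBasis_dotProduct_mul x]
  refine Finset.sum_congr rfl fun i _ ↦ ?_
  rw [eigenvectorBasis_dotProduct_mulVec]
  ring

lemma exists_eigenvalues_eq_eigenvalues₀ (hA : A.IsHermitian) :
    ∃ e : Fin (Fintype.card n) ≃ n, ∀ j, hA.eigenvalues (e j) = hA.eigenvalues₀ j :=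
  ⟨Fintype.equivOfCardEq (Fintype.card_fin _), fun j ↦ by simp [eigenvalues]⟩

end Matrix.IsHermitian

/-! ### The Laplacian form and toughness -/

namespace SimpleGraph

open Matrix

variable {V : Type*} [Fintype V] (G : SimpleGraph V) [DecidableRel G.Adj]

/-- The quadratic form of the Laplacian matrix, as the sum of `(x a - x b) ^ 2` over the edges. -/
noncomputable def energy (x : V → ℝ) : ℝ :=
  (∑ a, ∑ b, if G.Adj a b then (x a - x b) ^ 2 else 0) / 2

lemma energy_sub_const (x : V → ℝ) (c : ℝ) : G.energy (fun v ↦ x v - c) = G.energy x := by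
  simp [energy]

variable [DecidableEq V]

lemma dotProduct_lapMatrix_mulVec (x : V → ℝ) : x ⬝ᵥ (G.lapMatrix ℝ *ᵥ x) = G.energy x := by
  rw [← toLinearMap₂'_apply', lapMatrix_toLinearMap₂', energy]

lemma energy_le_lapEigenvalue_card_mul (hn : 1 ≤ Fintype.card V) (x : V → ℝ) :
    G.energy x ≤ G.lapEigenvalue (Fintype.card V) hn le_rfl * (x ⬝ᵥ x) := by
  have hA := G.isHermitian_lapMatrix ℝ
  obtain ⟨e, he⟩ := hA.exists_eigenvalues_eq_eigenvalues₀
  rw [← dotProduct_lapMatrix_mulVec, hA.dotProduct_mulVec_eq_sum,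
    ← hA.sum_eigenvectorBasis_dotProduct_mul, Finset.mul_sum]
  refine Finset.sum_le_sum fun i _ ↦ ?_
  rw [← pow_two]
  refine mul_le_mul_of_nonneg_right ?_ (sq_nonneg _)
  obtain ⟨j, rfl⟩ := e.surjective i
  rw [he]
  refine hA.eigenvalues₀_antitone (Fin.le_def.2 ?_)
  simp

variable {G}

lemma Connected.eq_of_eigenvalues_eq_zero (hG : G.Connected) {i j : V}
    (hi : (G.isHermitian_lapMatrix ℝ).eigenvalues i = 0)
    (hj : (G.isHermitian_lapMatrix ℝ).eigenvalues j = 0) : i = j := by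
  have hA := G.isHermitian_lapMatrix ℝ
  set b := hA.eigenvectorBasis with hb
  -- eigenvectors with eigenvalue zero are constant
  have hconst : ∀ l, hA.eigenvalues l = 0 → ∀ u v, b l u = b l v := by
    intro l hl u v
    have h0 : G.lapMatrix ℝ *ᵥ ⇑(b l) = 0 := by rw [hb, hA.mulVec_eigenvectorBasis, hl, zero_smul]
    exact (G.lapMatrix_mulVec_eq_zero_iff_forall_reachable).1 h0 u v (hG.preconnected u v)
  have hne : ∀ l, hA.eigenvalues l = 0 → b l i ≠ 0 := by
    intro l hl h0
    refine b.orthonormal.ne_zero l ?_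
    ext v
    rw [hconst l hl v i, h0]
    rfl
  by_contra hij
  have h : inner ℝ (b i) (b j) = 0 := b.orthonormal.2 hij
  rw [EuclideanSpace.inner_eq_star_dotProduct, star_trivial, dotProduct] at h
  rw [Finset.sum_congr rfl fun v _ ↦ by rw [hconst i hi v i, hconst j hj v i]] at h
  have : Nonempty V := ⟨i⟩
  simp [hne i hi, hne j hj] at h

lemma Connected.lapEigenvalue_two_pos (hG : G.Connected) (hn : 2 ≤ Fintype.card V) :
    0 < G.lapEigenvalue 2 one_le_two hn := by
  have hA := G.isHermitian_lapMatrix ℝ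
  obtain ⟨e, he⟩ := hA.exists_eigenvalues_eq_eigenvalues₀
  have hnonneg := (G.posSemidef_lapMatrix ℝ).eigenvalues_nonneg
  by_contra hneg
  rw [not_lt] at hneg
  have h1 : hA.eigenvalues (e ⟨Fintype.card V - 2, by omega⟩) = 0 :=
    le_antisymm (by rw [he]; exact hneg) (hnonneg _)
  have h2 : hA.eigenvalues (e ⟨Fintype.card V - 1, by omega⟩) = 0 := by
    refine le_antisymm ?_ (hnonneg _)
    rw [← h1, he, he]
    exact hA.eigenvalues₀_antitone (Fin.le_def.2 (by simp only; omega))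
  have := e.injective (hG.eq_of_eigenvalues_eq_zero h1 h2)
  simp only [Fin.mk.injEq] at this
  omega

lemma Connected.lapEigenvalue_two_mul_le_energy (hG : G.Connected) (hn : 2 ≤ Fintype.card V)
    {x : V → ℝ} (hx : ∑ v, x v = 0) :
    G.lapEigenvalue 2 one_le_two hn * (x ⬝ᵥ x) ≤ G.energy x := by
  have hA := G.isHermitian_lapMatrix ℝ
  obtain ⟨e, he⟩ := hA.exists_eigenvalues_eq_eigenvalues₀
  have hpos := hG.lapEigenvalue_two_pos hn
  set i₀ := e ⟨Fintype.card V - 1, by omega⟩ with hi₀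
  have hge : ∀ i ≠ i₀, G.lapEigenvalue 2 one_le_two hn ≤ hA.eigenvalues i := by
    intro i hi
    obtain ⟨j, rfl⟩ := e.surjective i
    have hj : j.1 ≠ Fintype.card V - 1 := fun h ↦ hi (congrArg e (Fin.ext h))
    rw [he]
    exact hA.eigenvalues₀_antitone (Fin.le_def.2 (by simp only; omega))
  have hone : ∀ i ≠ i₀, ⇑(hA.eigenvectorBasis i) ⬝ᵥ (fun _ ↦ (1 : ℝ)) = 0 := by
    intro i hi
    have h := hA.eigenvectorBasis_dotProduct_mulVec i (fun _ ↦ 1)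
    rw [lapMatrix_mulVec_const_eq_zero, dotProduct_zero] at h
    exact (mul_eq_zero.1 h.symm).resolve_left (hpos.trans_le (hge i hi)).ne'
  have hexp (y : V → ℝ) : (⇑(hA.eigenvectorBasis i₀) ⬝ᵥ y) *
      (⇑(hA.eigenvectorBasis i₀) ⬝ᵥ fun _ ↦ (1 : ℝ)) = ∑ v, y v := by
    have h := hA.sum_eigenvectorBasis_dotProduct_mul y (fun _ ↦ 1)
    rw [Finset.sum_eq_single i₀ (fun i _ hi ↦ by rw [hone i hi, mul_zero]) (by simp)] at h
    rw [h]
    simp [dotProduct]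
  -- `x` is orthogonal to the only eigenvector that is not orthogonal to the constants
  have hx0 : ⇑(hA.eigenvectorBasis i₀) ⬝ᵥ x = 0 := by
    have h1 := hexp x
    rw [hx] at h1
    refine (mul_eq_zero.1 h1).resolve_right fun h0 ↦ ?_
    have h2 := hexp fun _ ↦ 1
    have : Nonempty V := hG.nonempty
    rw [h0, mul_zero, Finset.sum_const, nsmul_one, Finset.card_univ] at h2
    exact absurd h2.symm (by simp)
  rw [← dotProduct_lapMatrix_mulVec, hA.dotProduct_mulVec_eq_sum,
    ← hA.sum_eigenvectorBasis_dotProduct_mul, Finset.mul_sum]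
  refine Finset.sum_le_sum fun i _ ↦ ?_
  by_cases hi : i = i₀
  · simp [hi, hx0]
  · rw [← pow_two]
    exact mul_le_mul_of_nonneg_right (hge i hi) (sq_nonneg _)

/-- The indicator function of a set of `a` vertices, made orthogonal to the constants, has squared
norm `a (n - a) / n`. -/
lemma dotProduct_indicator_centered [Nonempty V] (A : Finset V) :
    (fun v ↦ (if v ∈ A then 1 else 0 : ℝ) - A.card / Fintype.card V) ⬝ᵥ
      (fun v ↦ (if v ∈ A then 1 else 0 : ℝ) - A.card / Fintype.card V) =
      A.card * (Fintype.card V - A.card) / Fintype.card V := by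
  have hn : (Fintype.card V : ℝ) ≠ 0 := by simp
  simp only [dotProduct, sub_mul, mul_sub, Finset.sum_sub_distrib, ← Finset.sum_mul,
    ← Finset.mul_sum]
  simp
  field_simp
  ring

lemma card_mul_energy_indicator_le (hn : 1 ≤ Fintype.card V) (A : Finset V) :
    Fintype.card V * G.energy (fun v ↦ if v ∈ A then 1 else 0) ≤
      G.lapEigenvalue (Fintype.card V) hn le_rfl * (A.card * (Fintype.card V - A.card)) := by
  have : Nonempty V := Fintype.card_pos_iff.1 hn
  have hn0 : (0 : ℝ) < Fintype.card V := by exact_mod_cast hn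
  have h := G.energy_le_lapEigenvalue_card_mul hn
    (fun v ↦ (if v ∈ A then 1 else 0) - A.card / Fintype.card V)
  rw [energy_sub_const, dotProduct_indicator_centered, mul_div_assoc', le_div_iff₀ hn0] at h
  linarith

lemma Connected.le_card_mul_energy_indicator (hG : G.Connected) (hn : 2 ≤ Fintype.card V)
    (A : Finset V) :
    G.lapEigenvalue 2 one_le_two hn * (A.card * (Fintype.card V - A.card)) ≤
      Fintype.card V * G.energy (fun v ↦ if v ∈ A then 1 else 0) := by
  have : Nonempty V := hG.nonempty
  have hn0 : (0 : ℝ) < Fintype.card V := by simp [Fintype.card_pos]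
  have h := hG.lapEigenvalue_two_mul_le_energy hn
    (x := fun v ↦ (if v ∈ A then 1 else 0) - A.card / Fintype.card V)
    (by simp [Finset.sum_sub_distrib]; field_simp; simp)
  rw [energy_sub_const, dotProduct_indicator_centered, mul_div_assoc', div_le_iff₀ hn0] at h
  linarith

/-- Here `f` sends a vertex to its component in `G - S`, and `I` is the set of components of `G - S`.
The energy of an indicator function is the number of edges leaving the set; every edge that leaves a
component of `G - S` ends in `S`, so the components together have as many leaving edges as `S`. -/
lemma sum_energy_indicator_eq {ι : Type*} [DecidableEq ι] (f : V → ι) (I : Finset ι)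
    (S : Finset V) (hf : ∀ v, f v ∈ I ↔ v ∉ S)
    (hadj : ∀ a b, G.Adj a b → a ∉ S → b ∉ S → f a = f b) :
    ∑ i ∈ I, G.energy (fun v ↦ if v ∈ Finset.univ.filter (f · = i) then 1 else 0) =
      G.energy (fun v ↦ if v ∈ S then 1 else 0) := by
  simp only [energy]
  rw [← Finset.sum_div, Finset.sum_comm]
  congr 1
  refine Finset.sum_congr rfl fun a _ ↦ ?_
  rw [Finset.sum_comm]
  refine Finset.sum_congr rfl fun b _ ↦ ?_
  by_cases hab : G.Adj a b
  · simp only [hab, if_true, Finset.mem_filter, Finset.mem_univ, true_and]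
    have hS : ∀ v ∈ S, ∀ i ∈ I, f v ≠ i := fun v hv i hi h ↦ (hf v).1 (h ▸ hi) hv
    have hone : ∀ v, v ∉ S → ∑ i ∈ I, (if f v = i then 1 else 0 : ℝ) = 1 := fun v hv ↦ by
      simp [(hf v).2 hv]
    by_cases ha : a ∈ S <;> by_cases hb : b ∈ S
    · rw [Finset.sum_eq_zero fun i hi ↦ by simp [hS a ha i hi, hS b hb i hi]]
      simp [ha, hb]
    · rw [Finset.sum_congr rfl fun i hi ↦ by
        rw [if_neg (hS a ha i hi), zero_sub, neg_sq, ite_pow, one_pow, zero_pow two_ne_zero],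
        hone b hb]
      simp [ha, hb]
    · rw [Finset.sum_congr rfl fun i hi ↦ by
        rw [if_neg (hS b hb i hi), sub_zero, ite_pow, one_pow, zero_pow two_ne_zero], hone a ha]
      simp [ha, hb]
    · rw [Finset.sum_eq_zero fun i _ ↦ by simp [hadj a b hab ha hb]]
      simp [ha, hb]
  · simp [hab]

/-- Positive integers `m i`, `i ∈ I`, with sum `N` satisfy `∑ m i (N - m i) ≥ (|I| - 1) N`. -/
lemma card_sub_one_mul_le_sum {ι : Type*} (I : Finset ι) (m : ι → ℕ)
    (hm : ∀ i ∈ I, 1 ≤ m i) :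
    ((I.card : ℝ) - 1) * ∑ i ∈ I, (m i : ℝ) ≤
      ∑ i ∈ I, (m i : ℝ) * (∑ j ∈ I, (m j : ℝ) - m i) := by
  classical
  rw [Finset.mul_sum]
  refine Finset.sum_le_sum fun i hi ↦ ?_
  rw [mul_comm]
  refine mul_le_mul_of_nonneg_left ?_ (Nat.cast_nonneg _)
  rw [← Finset.add_sum_erase I _ hi, add_sub_cancel_left]
  have h : ∑ j ∈ I.erase i, (1 : ℝ) ≤ ∑ j ∈ I.erase i, (m j : ℝ) :=
    Finset.sum_le_sum fun j hj ↦ by exact_mod_cast hm j (Finset.mem_of_mem_erase hj)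
  rw [Finset.sum_const, nsmul_one, Finset.card_erase_of_mem hi,
    Nat.cast_sub (Finset.card_pos.2 ⟨i, hi⟩)] at h
  simpa using h

/-- A spectral bound on the toughness: if `μ_n ≤ (k - 1) μ_2`, then `G - S` has at most
`(k - 2)|S| + 1` components for every `S`. As the vertices of `S` count as components of
`G.isolate S`, both sides are stated with `2|S|` more. -/
theorem Connected.card_component_isolate_le (hG : G.Connected) (hn : 2 ≤ Fintype.card V) {k : ℕ}
    (hk : 2 ≤ k)
    (hμ : G.lapEigenvalue (Fintype.card V) (one_le_two.trans hn) le_rfl ≤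
      ((k : ℝ) - 1) * G.lapEigenvalue 2 one_le_two hn) (S : Finset V) :
    Nat.card (G.isolate S).ConnectedComponent + S.card ≤ k * S.card + 1 := by
  classical
  have := Fintype.ofFinite (G.isolate S).ConnectedComponent
  let f : V → (G.isolate S).ConnectedComponent := (G.isolate S).connectedComponentMk
  let I : Finset (G.isolate S).ConnectedComponent := Finset.univ \ S.image f
  have hf : ∀ v, f v ∈ I ↔ v ∉ S := by
    intro v
    simp only [I, Finset.mem_sdiff, Finset.mem_univ, true_and, Finset.mem_image, not_exists,
      not_and]
    refine ⟨fun h hv ↦ h v hv rfl, fun hv w hw h ↦ hv ?_⟩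
    have : w = v := eq_of_reachable_isolate (ConnectedComponent.exact h) (Finset.mem_coe.2 hw)
    exact this ▸ hw
  have hcard : Nat.card (G.isolate S).ConnectedComponent ≤ I.card + S.card := by
    rw [Nat.card_eq_fintype_card, ← Finset.card_univ]
    have h1 := Finset.le_card_sdiff (S.image f) Finset.univ
    have h2 : (S.image f).card ≤ S.card := Finset.card_image_le
    have h3 : I.card = (Finset.univ \ S.image f).card := rfl
    omega
  suffices hI : (I.card : ℝ) ≤ (k - 2) * S.card + 1 by
    have : (I.card : ℝ) + 2 * S.card ≤ k * S.card + 1 := by linarith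
    have : I.card + 2 * S.card ≤ k * S.card + 1 := by exact_mod_cast this
    omega
  let m : (G.isolate S).ConnectedComponent → ℕ := fun i ↦ (Finset.univ.filter (f · = i)).card
  have hm : ∀ i ∈ I, 1 ≤ m i := by
    rintro ⟨v⟩ _
    exact Finset.card_pos.2 ⟨v, by simp [f]; rfl⟩
  set N : ℝ := ∑ i ∈ I, (m i : ℝ) with hN
  have hNS : N + S.card = Fintype.card V := by
    have h1 : Sᶜ.card = ∑ i ∈ I, m i := by
      rw [Finset.card_eq_sum_card_fiberwise (f := f) (t := I)
        (fun v hv ↦ (hf v).2 (by simpa using hv))]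
      refine Finset.sum_congr rfl fun i hi ↦ congrArg _ ?_
      ext v
      simp only [Finset.mem_filter, Finset.mem_compl, Finset.mem_univ, true_and,
        and_iff_right_iff_imp]
      rintro rfl
      exact (hf v).1 hi
    have h2 := Finset.card_compl_add_card S
    rw [h1] at h2
    rw [hN, ← h2]
    push_cast
    rfl
  rcases I.eq_empty_or_nonempty with hI0 | ⟨i, hi⟩
  · rw [hI0, Finset.card_empty, Nat.cast_zero]
    have : (2 : ℝ) ≤ k := by exact_mod_cast hk
    have : 0 ≤ ((k : ℝ) - 2) * S.card := mul_nonneg (by linarith) (Nat.cast_nonneg _)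
    linarith
  have hNpos : 0 < N :=
    Finset.sum_pos (fun j hj ↦ by exact_mod_cast hm j hj) ⟨i, hi⟩
  have hadj : ∀ a b, G.Adj a b → a ∉ S → b ∉ S → f a = f b := fun a b hab ha hb ↦
    ConnectedComponent.sound
      (Adj.reachable (isolate_adj.2 ⟨hab, by simpa using ha, by simpa using hb⟩))
  set μ := G.lapEigenvalue 2 one_le_two hn with hμdef
  have hpos : 0 < μ := hG.lapEigenvalue_two_pos hn
  have hlow : μ * ∑ i ∈ I, (m i : ℝ) * (Fintype.card V - m i) ≤
      Fintype.card V * G.energy (fun v ↦ if v ∈ S then 1 else 0) := by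
    rw [← G.sum_energy_indicator_eq f I S hf hadj, Finset.mul_sum, Finset.mul_sum]
    exact Finset.sum_le_sum fun i _ ↦ hG.le_card_mul_energy_indicator hn _
  have hup := G.card_mul_energy_indicator_le (one_le_two.trans hn) S
  have hsum : ∑ i ∈ I, (m i : ℝ) * (Fintype.card V - m i) =
      S.card * N + ∑ i ∈ I, (m i : ℝ) * (N - m i) := by
    rw [← hNS, hN, Finset.mul_sum, ← Finset.sum_add_distrib]
    exact Finset.sum_congr rfl fun i _ ↦ by ring
  have hcomb := card_sub_one_mul_le_sum I m hm
  rw [← hN] at hcomb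
  have hVS : (Fintype.card V : ℝ) - S.card = N := by linarith
  rw [hVS] at hup
  have hSN : 0 ≤ (S.card : ℝ) * N := mul_nonneg (Nat.cast_nonneg _) hNpos.le
  have h1 : μ * (S.card * N + (I.card - 1) * N) ≤ (k - 1) * μ * (S.card * N) := by
    calc μ * (S.card * N + (I.card - 1) * N)
        ≤ μ * (S.card * N + ∑ i ∈ I, (m i : ℝ) * (N - m i)) :=
          mul_le_mul_of_nonneg_left (by linarith) hpos.le
      _ ≤ _ := by rw [← hsum]; exact hlow.trans hup
      _ ≤ _ := mul_le_mul_of_nonneg_right hμ hSN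
  have h2 : (μ * N) * I.card ≤ (μ * N) * ((k - 2) * S.card + 1) := by linarith
  exact le_of_mul_le_mul_left h2 (mul_pos hpos hNpos)

end SimpleGraph

theorem theorem4p2 {V : Type*} [Fintype V] [DecidableEq V] (G : SimpleGraph V)
    [DecidableRel G.Adj] (k : ℕ) (hk : 3 ≤ k) (hn : 2 ≤ Fintype.card V) (hG : G.Connected)
    (hμ : G.lapEigenvalue (Fintype.card V) (by omega) le_rfl ≤
      ((k : ℝ) - 1) * G.lapEigenvalue 2 (by omega) hn) :
    ∃ (T : SimpleGraph V) (_ : DecidableRel T.Adj), T ≤ G ∧ T.IsTree ∧ T.maxDegree ≤ k := by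
  classical
  have : Nonempty V := hG.nonempty
  obtain ⟨T, hTG, hT, hdeg⟩ := SimpleGraph.exists_isTree_of_card_component_isolate_le
    (hG.card_component_isolate_le hn (by omega) hμ)
  refine ⟨T, inferInstance, hTG, hT, T.maxDegree_le_of_forall_degree_le k fun v ↦ ?_⟩
  rw [← SimpleGraph.card_neighborSet_eq_degree, ← Nat.card_eq_fintype_card, Nat.card_coe_set_eq]
  exact hdeg v
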